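/- Theorem 2.2. Let $P_1,\dots,P_n$ be mutually independent random variables, $P_i$ taking values in a measurable space $\Omega_i$ with distribution $\mu_i$, and let $\Pr=\mu_1\otimes\cdots\otimes\mu_n$. An event is a measurable set $B\subseteq\prod_i\Omega_i$ of assignments; $\mathrm{vbl}(B)$ denotes the smallest subset of the variables that determines $B$. Let $\mathcal A$ be a finite set of (bad) events, and for any event $B$ (in $\mathcal A$ or not) let $$\Gamma(B)=\{A\in\mathcal A : A\neq B,\ \mathrm{vbl}(A)\cap\mathrm{vbl}(B)\neq\emptyset\}.$$ The Moser–Tardos (MT) algorithm on $\mathcal A$ first samples all $P_i$ independently from their distributions; then, while some event of $\mathcal A$ is true under the current assignment, it picks a currently true $A\in\mathcal A$ and replaces the values of the variables in $\mathrm{vbl}(A)$ by fresh independent samples from their distributions. The rule for picking $A$ is arbitrary: it may depend measurably on all assignments seen so far and on random bits that are independent of all samples. Suppose that there is an assignment of reals $x:\mathcal A\to(0,1)$, $C\mapsto x_C$, such that $$\forall A\in\mathcal A:\qquad \Pr[A]\le x_A\prod_{C\in\Gamma(A)}(1-x_C).$$ Then, for every such picking rule, the MT algorithm stops almost surely, so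 that its output distribution is well defined, and for every event $B$ the probability that $B$ is true at least once during the execution of the algorithm (that is, under the initial assignment or under the assignment after some resampling step) is at most $$\Pr[B]\cdot\Bigl(\prod_{C\in\Gamma(B)}(1-x_C)\Bigr)^{-1}.$$ In particular, the probability that $B$ is true under the output of the algorithm is at most this same bound. -/

import Mathlib

open MeasureTheory

noncomputable section

namespace MoserTardos

universe u v w

variable {ι : Type u} {Ω : ι → Type v}

/-- The variables of an event `B`: the smallest set of variables that determines `B`. An event is a
set of assignments, and a set `S` of variables determines it if two assignments that agree
on `S` are both in `B` or both outside `B`. -/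
def vbl (B : Set (∀ i, Ω i)) : Set ι :=
  ⋂₀ {S : Set ι | DependsOn (fun a : ∀ i, Ω i => a ∈ B) S}

theorem dependsOn_inter {B : Set (∀ i, Ω i)} {S T : Set ι}
    (hS : DependsOn (fun a : ∀ i, Ω i => a ∈ B) S)
    (hT : DependsOn (fun a : ∀ i, Ω i => a ∈ B) T) :
    DependsOn (fun a : ∀ i, Ω i => a ∈ B) (S ∩ T) := by
  classical
  intro a b hab
  have h1 : (a ∈ B) = ((fun i => if i ∈ S then a i else b i) ∈ B) :=
    hS (fun i hi => by simp [hi])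
  have h2 : ((fun i => if i ∈ S then a i else b i) ∈ B) = (b ∈ B) := by
    refine hT (fun i hi => ?_)
    by_cases h : i ∈ S
    · simpa [h] using hab i ⟨h, hi⟩
    · simp [h]
  exact h1.trans h2

/-- With finitely many variables, `vbl B` does determine `B`, so it is the smallest such set. -/
theorem dependsOn_vbl [Finite ι] (B : Set (∀ i, Ω i)) :
    DependsOn (fun a : ∀ i, Ω i => a ∈ B) (vbl B) := by
  have key : ∀ F : Set (Set ι), F.Finite →
      (∀ S ∈ F, DependsOn (fun a : ∀ i, Ω i => a ∈ B) S) →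
      DependsOn (fun a : ∀ i, Ω i => a ∈ B) (⋂₀ F) := by
    intro F hF
    induction F, hF using Set.Finite.induction_on with
    | empty =>
      intro _ a b hab
      have : a = b := funext fun i => hab i (by simp)
      rw [this]
    | insert _ _ ih =>
      intro h
      rw [Set.sInter_insert]
      exact dependsOn_inter (h _ (Set.mem_insert _ _))
        (ih fun S hS => h S (Set.mem_insert_of_mem _ hS))
  exact key _ (Set.toFinite _) fun S hS => hS

theorem vbl_subset {B : Set (∀ i, Ω i)} {S : Set ι}
    (hS : DependsOn (fun a : ∀ i, Ω i => a ∈ B) S) : vbl B ⊆ S :=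
  Set.sInter_subset_of_mem hS

open Classical in
/-- `Γ(B)`: the events `A ≠ B` of the collection `𝒜` that share a variable with `B`. The event `B`
need not belong to `𝒜`. -/
def nbhd (𝒜 : Finset (Set (∀ i, Ω i))) (B : Set (∀ i, Ω i)) : Finset (Set (∀ i, Ω i)) :=
  {A ∈ 𝒜 | A ≠ B ∧ (vbl A ∩ vbl B).Nonempty}

variable [∀ i, MeasurableSpace (Ω i)]

/-- An arbitrary rule by which the algorithm picks, after `t` resamplings, a bad event that is
currently true. The rule sees all assignments `h 0, …, h t` up to now, and it may be randomized:
`seed` stands for its own random bits. It returns `none` exactly when no bad event is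
currently true, in which case the algorithm stops. -/
structure SelectionRule (𝒜 : Finset (Set (∀ i, Ω i))) (Seed : Type w) [MeasurableSpace Seed] where
  pick : Seed → (t : ℕ) → (Fin (t + 1) → ∀ i, Ω i) → Option 𝒜
  pick_some : ∀ (seed : Seed) (t : ℕ) (h : Fin (t + 1) → ∀ i, Ω i) (A : 𝒜),
    pick seed t h = some A → h (Fin.last t) ∈ (A : Set (∀ i, Ω i))
  pick_none : ∀ (seed : Seed) (t : ℕ) (h : Fin (t + 1) → ∀ i, Ω i),
    pick seed t h = none → ∀ A ∈ 𝒜, h (Fin.last t) ∉ A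
  measurableSet_pick : ∀ (t : ℕ) (o : Option 𝒜),
    MeasurableSet {p : Seed × (Fin (t + 1) → ∀ i, Ω i) | pick p.1 t p.2 = o}

variable {𝒜 : Finset (Set (∀ i, Ω i))} {Seed : Type w} [MeasurableSpace Seed]

/-- The randomness of a run: the random bits `ω.1` of the selection rule, and for every variable `i`
a stream `ω.2 (i, 0), ω.2 (i, 1), …` of draws; `ω.2 (i, k)` is the value that the variable `i`
receives when it is resampled for the `k`-th time (its initial value if `k = 0`). -/
abbrev Sample (Ω : ι → Type v) (Seed : Type w) : Type (max u v w) :=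
  Seed × (∀ p : ι × ℕ, Ω p.1)

/-- All draws are independent of each other and of the random bits of the selection rule, and
every draw of the variable `i` has the distribution `μ i` of that variable. -/
def runMeasure (μ : ∀ i, Measure (Ω i)) [∀ i, IsProbabilityMeasure (μ i)] (ν : Measure Seed) :
    Measure (Sample Ω Seed) :=
  ν.prod (Measure.infinitePi fun p : ι × ℕ => μ p.1)

open Classical in
/-- The first `t` steps of a run: the assignments at the times `0, …, t`, and for every variable the
number of times it has been resampled. While a bad event is true, one such event `A` is picked,
and precisely the variables of `A` receive fresh draws. After the algorithm has stopped, the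
assignment does not change any more. -/
def history (rule : SelectionRule 𝒜 Seed) (ω : Sample Ω Seed) :
    (t : ℕ) → (Fin (t + 1) → ∀ i, Ω i) × (ι → ℕ)
  | 0 => (fun _ i => ω.2 (i, 0), fun _ => 0)
  | t + 1 =>
    let h := (history rule ω t).1
    let k := (history rule ω t).2
    match rule.pick ω.1 t h with
    | none => (Fin.snoc (α := fun _ => ∀ i, Ω i) h (h (Fin.last t)), k)
    | some A =>
      (Fin.snoc (α := fun _ => ∀ i, Ω i) h
          (fun i => if i ∈ vbl (A : Set (∀ i, Ω i)) then ω.2 (i, k i + 1) else h (Fin.last t) i),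
        fun i => if i ∈ vbl (A : Set (∀ i, Ω i)) then k i + 1 else k i)

/-- The assignment at time `t` (after `t` resamplings, or the final one if the algorithm has
stopped earlier). -/
def assignment (rule : SelectionRule 𝒜 Seed) (ω : Sample Ω Seed) (t : ℕ) : ∀ i, Ω i :=
  (history rule ω t).1 (Fin.last t)

/-- The algorithm has stopped by time `t`: no bad event is true any more. -/
def StoppedAt (rule : SelectionRule 𝒜 Seed) (ω : Sample Ω Seed) (t : ℕ) : Prop :=
  rule.pick ω.1 t (history rule ω t).1 = none

open Classical in
/-- The output of the run: the assignment at which it stops, `none` if it runs forever. -/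
def output (rule : SelectionRule 𝒜 Seed) (ω : Sample Ω Seed) : Option (∀ i, Ω i) :=
  if h : ∃ t, StoppedAt rule ω t then some (assignment rule ω (Nat.find h)) else none

end MoserTardos

end

/-! The run only reads a table of independent draws, one stream per variable. If `B` is true at some
time, walk backwards through the resamplings and put each resampled event just below the deepest
layer containing an event that equals it or shares a variable with it; drop it if there is none.
Under the root `{B}` this builds layers, each with disjoint variables and inside the closed
neighbourhood of the layer above. For an event kept in the list, the draws of its variables used up
before it are counted by the deeper layers touching them. So the list alone determines the cells at
which its events must hold (`exists_layering`).

Distinct events of a list read disjoint cells, so a fixed list is consistent with the table with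
probability the product of its event probabilities, whatever the rule (`infinitePi_consistent`).
Summed over all lists whose first layer lies in `D`, these products are at most `∏ C ∈ D, (1 - x
C)⁻¹` (`sum_weight_layerings_le`).

At the first time that `B` is true it has not yet been resampled, so `D = Γ(B)` suffices and the
union bound gives the estimate. For termination take a bad event `A` as root: by Borel–Cantelli,
almost surely only finitely many lists are consistent, while different resamplings of `A` give
different lists (`finite_pick`). -/

namespace MoserTardos

/-! ### Layered witnesses and grafting -/

section Layers

variable {ι : Type*} {Ω : ι → Type*}

/-- Two events are related if they are equal or share a variable. -/
def Related (A C : Set (∀ i, Ω i)) : Prop :=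
  A = C ∨ (vbl A ∩ vbl C).Nonempty

/-- `A` is related to an event of the layer `I`. -/
def MeetsLayer (A : Set (∀ i, Ω i)) (I : Finset (Set (∀ i, Ω i))) : Prop :=
  ∃ C ∈ I, Related A C

/-- `A` is related to an event of one of the layers of `L`. -/
def Meets (A : Set (∀ i, Ω i)) (L : List (Finset (Set (∀ i, Ω i)))) : Prop :=
  ∃ I ∈ L, MeetsLayer A I

/-- The variables of the events of a layer. -/
def layerVbl (I : Finset (Set (∀ i, Ω i))) : Set ι :=
  {i | ∃ A ∈ I, i ∈ vbl A}

open Classical in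
/-- The number of layers of `L` that contain an event involving the variable `i`. -/
noncomputable def touches : List (Finset (Set (∀ i, Ω i))) → ι → ℕ
  | [], _ => 0
  | I :: L, i => touches L i + if i ∈ layerVbl I then 1 else 0

/-- The layers of `L`, the deepest ones first, are successively true when the algorithm is run on
the table `T` from which the first `c i` entries of every stream `i` have been removed. -/
def Consistent (T : ∀ p : ι × ℕ, Ω p.1) (c : ι → ℕ) : List (Finset (Set (∀ i, Ω i))) → Prop
  | [] => True
  | I :: L => (∀ A ∈ I, (fun i => T (i, c i + touches L i)) ∈ A) ∧ Consistent T c L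

open Classical in
/-- Insert an earlier event `A` below the layer `I` and the layers `L` under it, immediately below
the deepest layer to which it is related; it is dropped if it is related to no layer. -/
noncomputable def graft (A : Set (∀ i, Ω i)) :
    Finset (Set (∀ i, Ω i)) → List (Finset (Set (∀ i, Ω i))) → List (Finset (Set (∀ i, Ω i)))
  | I, [] => if MeetsLayer A I then [{A}] else []
  | I, J :: L =>
    if Meets A (J :: L) then J :: graft A J L
    else if MeetsLayer A I then insert A J :: L else J :: L

open Classical in
/-- The events of the collection that are related to an event of the layer `J`. -/
noncomputable def closedNbhd (𝒜 J : Finset (Set (∀ i, Ω i))) : Finset (Set (∀ i, Ω i)) :=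
  J.biUnion fun C => insert C (nbhd 𝒜 C)

/-- The lists of layers that can arise below a root whose possible children are in `D`. -/
def IsLayering (𝒜 : Finset (Set (∀ i, Ω i))) :
    Finset (Set (∀ i, Ω i)) → List (Finset (Set (∀ i, Ω i))) → Prop
  | _, [] => True
  | D, J :: L => J ⊆ D ∧ J.Nonempty ∧ (J : Set (Set (∀ i, Ω i))).PairwiseDisjoint vbl ∧
      IsLayering 𝒜 (closedNbhd 𝒜 J) L

variable {𝒜 : Finset (Set (∀ i, Ω i))} {A B : Set (∀ i, Ω i)} {I J D : Finset (Set (∀ i, Ω i))}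
  {L : List (Finset (Set (∀ i, Ω i)))} {c : ι → ℕ} {T : ∀ p : ι × ℕ, Ω p.1}

theorem meets_cons : Meets A (I :: L) ↔ MeetsLayer A I ∨ Meets A L := by
  simp [Meets]

theorem not_meets_nil : ¬ Meets A [] := by
  simp [Meets]

open Classical in
theorem mem_nbhd : A ∈ nbhd 𝒜 B ↔ A ∈ 𝒜 ∧ A ≠ B ∧ (vbl A ∩ vbl B).Nonempty := by
  simp [nbhd]

theorem nbhd_subset : nbhd 𝒜 B ⊆ 𝒜 :=
  fun _ hA => (mem_nbhd.1 hA).1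

theorem closedNbhd_subset (hJ : J ⊆ 𝒜) : closedNbhd 𝒜 J ⊆ 𝒜 := by
  classical
  exact Finset.biUnion_subset.2 fun C hC => Finset.insert_subset (hJ hC) nbhd_subset

theorem closedNbhd_mono (h : I ⊆ J) : closedNbhd 𝒜 I ⊆ closedNbhd 𝒜 J := by
  classical
  exact Finset.biUnion_subset_biUnion_of_subset_left _ h

theorem MeetsLayer.mem_closedNbhd (hA : A ∈ 𝒜) (h : MeetsLayer A J) : A ∈ closedNbhd 𝒜 J := by
  classical
  obtain ⟨C, hC, h⟩ := h
  refine Finset.mem_biUnion.2 ⟨C, hC, ?_⟩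
  rw [Finset.mem_insert, mem_nbhd]
  by_cases hAC : A = C
  · exact Or.inl hAC
  · exact Or.inr ⟨hA, hAC, h.resolve_left hAC⟩

theorem notMem_layerVbl (h : ¬ MeetsLayer A I) {i : ι} (hi : i ∈ vbl A) : i ∉ layerVbl I := by
  rintro ⟨C, hC, hiC⟩
  exact h ⟨C, hC, Or.inr ⟨i, hi, hiC⟩⟩

theorem touches_eq_zero (h : ¬ Meets A L) {i : ι} (hi : i ∈ vbl A) : touches L i = 0 := by
  induction L with
  | nil => rfl
  | cons I L ih =>
    rw [meets_cons, not_or] at h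
    simp [touches, ih h.2, notMem_layerVbl h.1 hi]

theorem IsLayering.mono {D' : Finset (Set (∀ i, Ω i))} (hD : D ⊆ D') :
    ∀ {L}, IsLayering 𝒜 D L → IsLayering 𝒜 D' L
  | [], _ => trivial
  | _ :: _, h => ⟨h.1.trans hD, h.2⟩

/-- Going below the deepest related layer keeps layers disjoint: `A` is unrelated to the layer it
joins. For the top layer, `hAD` replaces membership in a closed neighbourhood. -/
theorem IsLayering.graft (hA : A ∈ 𝒜) (hL : IsLayering 𝒜 D L) (hAD : MeetsLayer A I → A ∈ D) :
    IsLayering 𝒜 D (graft A I L) := by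
  classical
  induction L generalizing D I with
  | nil =>
    rw [MoserTardos.graft]
    split_ifs with h
    · exact ⟨by simpa using hAD h, by simp, by simp, trivial⟩
    · trivial
  | cons J L ih =>
    rw [MoserTardos.graft]
    split_ifs with h1 h2
    · exact ⟨hL.1, hL.2.1, hL.2.2.1, ih hL.2.2.2 fun h => h.mem_closedNbhd hA⟩
    · refine ⟨Finset.insert_subset (hAD h2) hL.1, by simp, ?_, ?_⟩
      · rw [Finset.coe_insert]
        refine hL.2.2.1.insert fun C hC _ => ?_
        rw [Set.disjoint_iff_inter_eq_empty, ← Set.not_nonempty_iff_eq_empty]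
        exact fun hne => h1 (meets_cons.2 (Or.inl ⟨C, hC, Or.inr hne⟩))
      · exact hL.2.2.2.mono (closedNbhd_mono (Finset.subset_insert _ _))
    · exact hL

theorem graft_of_not_meets (h : ¬ Meets A (I :: L)) : graft A I L = L := by
  rw [meets_cons, not_or] at h
  cases L with
  | nil => simp [graft, h.1]
  | cons J L => simp [graft, h.1, h.2]

-- The layer that receives `A` did not touch the variables of `A` before, so each of them gains
-- exactly one touch.
open Classical in
theorem touches_graft (h : Meets A (I :: L)) (i : ι) :
    touches (graft A I L) i = touches L i + if i ∈ vbl A then 1 else 0 := by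
  induction L generalizing I with
  | nil =>
    have h' : MeetsLayer A I := (meets_cons.1 h).resolve_right not_meets_nil
    simp [graft, h', touches, layerVbl]
  | cons J L ih =>
    by_cases h1 : Meets A (J :: L)
    · simp only [graft, if_pos h1, touches, ih h1]
      omega
    · have h2 := (meets_cons.1 h).resolve_right h1
      have h3 : i ∈ layerVbl (insert A J) ↔ i ∈ vbl A ∨ i ∈ layerVbl J := by
        simp [layerVbl]
      simp only [graft, if_neg h1, if_pos h2, touches, h3]
      by_cases hi : i ∈ vbl A
      · simp [hi, notMem_layerVbl (fun hJ => h1 (meets_cons.2 (Or.inl hJ))) hi]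
      · simp [hi]

/-- A dropped event shares no variable with `I`, so the count on the variables of `I` is right in
either case. -/
theorem touches_graft_of_mem_layerVbl [DecidablePred (· ∈ vbl A)] {i : ι} (hi : i ∈ layerVbl I) :
    touches (graft A I L) i = touches L i + if i ∈ vbl A then 1 else 0 := by
  by_cases h : Meets A (I :: L)
  · rw [touches_graft h]
    congr
  · have hA : i ∉ vbl A := fun hA => notMem_layerVbl (fun h' => h (meets_cons.2 (Or.inl h'))) hA hi
    simp [graft_of_not_meets h, hA]

variable [Finite ι]

theorem mem_congr {a b : ∀ i, Ω i} (h : ∀ i ∈ vbl A, a i = b i) : a ∈ A ↔ b ∈ A :=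
  iff_of_eq (dependsOn_vbl A h)

theorem layer_congr {a b : ∀ i, Ω i} (h : ∀ i ∈ layerVbl I, a i = b i) :
    (∀ C ∈ I, a ∈ C) ↔ ∀ C ∈ I, b ∈ C :=
  forall₂_congr fun C hC => mem_congr fun i hi => h i ⟨C, hC, hi⟩

/-- Prepending to the streams the draws consumed by an event `A` that is unrelated to the layers
does not matter. -/
theorem Consistent.of_not_meets {c' : ι → ℕ} (hc : ∀ i ∉ vbl A, c' i = c i) (h : ¬ Meets A L)
    (hL : Consistent T c' L) : Consistent T c L := by
  induction L with
  | nil => trivial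
  | cons I L ih =>
    rw [meets_cons, not_or] at h
    refine ⟨(layer_congr fun i hi => ?_).1 hL.1, ih h.2 hL.2⟩
    rw [hc i fun hA => notMem_layerVbl h.1 hA hi]

-- Above the insertion, the smaller offset and the additional touch cancel, so the same cells are
-- read. Deeper layers avoid the variables of `A`, hence `A` itself reads the cells at offset `c`,
-- where it is true.
open Classical in
theorem Consistent.graft {c' : ι → ℕ} (hc : ∀ i, c' i = c i + if i ∈ vbl A then 1 else 0)
    (hA : (fun i => T (i, c i)) ∈ A) (h : Consistent T c' (I :: L)) :
    Consistent T c (I :: graft A I L) := by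
  have hc' : ∀ i ∉ vbl A, c' i = c i := fun i hi => by simp [hc, hi]
  by_cases hm : Meets A (I :: L)
  swap
  · rw [graft_of_not_meets hm]
    exact h.of_not_meets hc' hm
  refine ⟨?_, ?_⟩
  · have : (fun i => T (i, c i + touches (MoserTardos.graft A I L) i)) =
        fun i => T (i, c' i + touches L i) := by
      funext i
      rw [touches_graft hm, hc]
      congr 2
      omega
    rw [this]
    exact h.1
  replace h := h.2
  induction L generalizing I with
  | nil =>
    have h' : MeetsLayer A I := (meets_cons.1 hm).resolve_right not_meets_nil
    simpa [MoserTardos.graft, h', Consistent, touches] using hA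
  | cons J L ih =>
    by_cases h1 : Meets A (J :: L)
    · rw [MoserTardos.graft, if_pos h1]
      refine ⟨?_, ih h1 h.2⟩
      have : (fun i => T (i, c i + touches (MoserTardos.graft A J L) i)) =
          fun i => T (i, c' i + touches L i) := by
        funext i
        rw [touches_graft h1, hc]
        congr 2
        omega
      rw [this]
      exact h.1
    · rw [MoserTardos.graft, if_neg h1, if_pos ((meets_cons.1 hm).resolve_right h1)]
      have h2 := h.of_not_meets hc' h1
      refine ⟨fun C hC => ?_, h2.2⟩
      rcases Finset.mem_insert.1 hC with rfl | hC
      · refine (mem_congr fun i hi => ?_).1 hA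
        rw [touches_eq_zero (fun h' => h1 (meets_cons.2 (Or.inr h'))) hi, add_zero]
      · exact h2.1 C hC

end Layers

/-! ### Independence in product measures -/

section Independence

variable {κ : Type*} {X : κ → Type*} [∀ k, MeasurableSpace (X k)]

/-- Under a product measure, events that depend on disjoint finite sets of coordinates are
independent. -/
theorem infinitePi_inter_of_dependsOn (m : ∀ k, Measure (X k)) [∀ k, IsProbabilityMeasure (m k)]
    {E F : Set (∀ k, X k)} {s t : Finset κ} (hE : MeasurableSet E) (hF : MeasurableSet F)
    (hEs : DependsOn (fun a : ∀ k, X k => a ∈ E) s) (hFt : DependsOn (fun a : ∀ k, X k => a ∈ F) t)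
    (hst : Disjoint s t) :
    Measure.infinitePi m (E ∩ F) = Measure.infinitePi m E * Measure.infinitePi m F := by
  classical
  have hne : ∀ k, Nonempty (X k) := fun k => nonempty_of_isProbabilityMeasure (m k)
  let base : ∀ k, X k := fun k => (hne k).some
  -- Padding with a fixed point exhibits an event depending on `u` as a measurable condition on the
  -- coordinates in `u`.
  let fill : ∀ u : Finset κ, (∀ k : u, X k) → ∀ k, X k := fun u a k =>
    if h : k ∈ u then a ⟨k, h⟩ else base k
  have hfill : ∀ u, Measurable (fill u) := fun u => by
    refine measurable_pi_lambda _ fun k => ?_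
    by_cases h : k ∈ u
    · simpa [fill, h] using measurable_pi_apply _
    · simp [fill, h]
  have hpre : ∀ (u : Finset κ) (G : Set (∀ k, X k)),
      DependsOn (fun a : ∀ k, X k => a ∈ G) u →
      (fun (a : ∀ k, X k) (k : u) => a k) ⁻¹' (fill u ⁻¹' G) = G := fun u G hG => by
    ext a
    refine iff_of_eq (hG fun k hk => ?_)
    simp [fill, Finset.mem_coe.1 hk]
  have hind : ProbabilityTheory.iIndepFun (fun k (a : ∀ k, X k) => a k)
      (Measure.infinitePi m) :=
    ProbabilityTheory.iIndepFun_infinitePi (X := fun k (a : X k) => a) fun k => measurable_id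
  have h := (hind.indepFun_finset s t hst fun k => measurable_pi_apply k).measure_inter_preimage_eq_mul
    _ _ (hfill s hE) (hfill t hF)
  rwa [hpre s E hEs, hpre t F hFt] at h

end Independence

/-! ### Probability that a list of layers is consistent -/

section Weights

theorem dependsOn_consistent {ι : Type*} [Finite ι] {Ω : ι → Type*} (c : ι → ℕ)
    (L : List (Finset (Set (∀ i, Ω i)))) :
    DependsOn (fun T : ∀ p : ι × ℕ, Ω p.1 => Consistent T c L)
      {p | p.2 < c p.1 + touches L p.1} := by
  classical
  induction L with
  | nil => exact fun _ _ _ => rfl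
  | cons J L ih =>
    intro T T' h
    have h1 : Consistent T c L = Consistent T' c L :=
      ih fun p hp => h p (by
        simp only [Set.mem_ofPred_eq, touches] at hp ⊢
        omega)
    have h2 : (∀ A ∈ J, (fun i => T (i, c i + touches L i)) ∈ A) =
        ∀ A ∈ J, (fun i => T' (i, c i + touches L i)) ∈ A :=
      propext (layer_congr fun i hi => h (i, c i + touches L i) (by simp [touches, hi]))
    simp only [Consistent, h1, h2]

variable {ι : Type*} {Ω : ι → Type*} [∀ i, MeasurableSpace (Ω i)]
  (μ : ∀ i, Measure (Ω i))

theorem pi_layer [Fintype ι] [∀ i, IsProbabilityMeasure (μ i)] (J : Finset (Set (∀ i, Ω i))) (hJ : ∀ A ∈ J, MeasurableSet A)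
    (hd : (J : Set (Set (∀ i, Ω i))).PairwiseDisjoint vbl) :
    Measure.pi μ {a | ∀ A ∈ J, a ∈ A} = ∏ A ∈ J, Measure.pi μ A := by
  classical
  induction J using Finset.induction_on with
  | empty => simp
  | insert A J hA ih =>
    rw [Finset.prod_insert hA, ← ih (fun C hC => hJ C (Finset.mem_insert_of_mem hC))
      (hd.subset (by simp)), ← Measure.infinitePi_eq_pi]
    have h : {a : ∀ i, Ω i | ∀ C ∈ insert A J, a ∈ C} = A ∩ {a | ∀ C ∈ J, a ∈ C} := by
      ext a
      simp
    rw [h]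
    refine infinitePi_inter_of_dependsOn μ (s := (vbl A).toFinset) (t := (layerVbl J).toFinset)
      (hJ A (Finset.mem_insert_self _ _)) ?_ ?_ ?_ ?_
    · simp only [Set.ofPred_forall]
      exact Finset.measurableSet_biInter _ fun C hC => hJ C (Finset.mem_insert_of_mem hC)
    · rw [Set.coe_toFinset]
      exact dependsOn_vbl A
    · rw [Set.coe_toFinset]
      exact fun a b hab => propext (layer_congr hab)
    · rw [Set.disjoint_toFinset, Set.disjoint_left]
      rintro i hi ⟨C, hC, hiC⟩
      exact Set.disjoint_left.1 (hd (by simp) (by simp [hC]) (by rintro rfl; exact hA hC)) hi hiC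

/-- The total weight of a list of layers. -/
noncomputable def weight [Fintype ι] (L : List (Finset (Set (∀ i, Ω i)))) : ℝ :=
  (L.map fun J => ∏ A ∈ J, (Measure.pi μ).real A).prod

theorem weight_nonneg [Fintype ι] (L : List (Finset (Set (∀ i, Ω i)))) : 0 ≤ weight μ L :=
  List.prod_nonneg fun a ha => by
    obtain ⟨J, -, rfl⟩ := List.mem_map.1 ha
    positivity

theorem weight_cons [Fintype ι] (J : Finset (Set (∀ i, Ω i))) (L : List (Finset (Set (∀ i, Ω i)))) :
    weight μ (J :: L) = (∏ A ∈ J, (Measure.pi μ).real A) * weight μ L := by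
  simp [weight]

theorem measurable_read (c : ι → ℕ) :
    Measurable fun (T : ∀ p : ι × ℕ, Ω p.1) i => T (i, c i) :=
  measurable_pi_lambda _ fun i => measurable_pi_apply (i, c i)

theorem measurableSet_consistent (c : ι → ℕ) {L : List (Finset (Set (∀ i, Ω i)))}
    (hL : ∀ J ∈ L, ∀ A ∈ J, MeasurableSet A) :
    MeasurableSet {T : ∀ p : ι × ℕ, Ω p.1 | Consistent T c L} := by
  induction L with
  | nil => simp [Consistent]
  | cons J L ih =>
    refine MeasurableSet.inter (s₁ := {T | ∀ A ∈ J, (fun i => T (i, c i + touches L i)) ∈ A}) ?_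
      (ih fun K hK => hL K (List.mem_cons_of_mem _ hK))
    simp only [Set.ofPred_forall]
    exact Finset.measurableSet_biInter _ fun A hA =>
      measurable_read (fun i => c i + touches L i) (hL J List.mem_cons_self A hA)

theorem infinitePi_read [Fintype ι] [∀ i, IsProbabilityMeasure (μ i)]
    (c : ι → ℕ) {E : Set (∀ i, Ω i)} (hE : MeasurableSet E) :
    Measure.infinitePi (fun p : ι × ℕ => μ p.1) {T | (fun i => T (i, c i)) ∈ E} =
      Measure.pi μ E := by
  have hinj : Function.Injective fun i => (i, c i) := fun i j h => (Prod.ext_iff.1 h).1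
  rw [← Measure.infinitePi_eq_pi,
    ← Measure.map_infinitePi_infinitePi_of_inj (P := fun p : ι × ℕ => μ p.1) hinj,
    Measure.map_apply (measurable_read c) hE]
  rfl

/-- The top layer reads draw `c i + touches L i` of stream `i`, and the deeper layers depend only on
draws with smaller index. Hence the layers are independent, and so are the events within a layer. -/
theorem infinitePi_consistent [Fintype ι] [∀ i, IsProbabilityMeasure (μ i)]
    (c : ι → ℕ)
    {L : List (Finset (Set (∀ i, Ω i)))}
    (hL : ∀ J ∈ L, ∀ A ∈ J, MeasurableSet A)
    (hd : ∀ J ∈ L, (J : Set (Set (∀ i, Ω i))).PairwiseDisjoint vbl) :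
    (Measure.infinitePi fun p : ι × ℕ => μ p.1) {T | Consistent T c L} =
      ENNReal.ofReal (weight μ L) := by
  classical
  induction L with
  | nil => simp [Consistent, weight]
  | cons J L ih =>
    have hL' : ∀ K ∈ L, ∀ A ∈ K, MeasurableSet A := fun K hK => hL K (List.mem_cons_of_mem _ hK)
    have hJ := hL J List.mem_cons_self
    have hT := measurable_read (Ω := Ω) fun i => c i + touches L i
    have hJm : MeasurableSet {a : ∀ i, Ω i | ∀ A ∈ J, a ∈ A} := by
      simp only [Set.ofPred_forall]
      exact Finset.measurableSet_biInter _ hJ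
    have h : {T : ∀ p : ι × ℕ, Ω p.1 | Consistent T c (J :: L)} =
        {T | (fun i => T (i, c i + touches L i)) ∈ {a : ∀ i, Ω i | ∀ A ∈ J, a ∈ A}} ∩
          {T | Consistent T c L} := by
      rfl
    rw [h, infinitePi_inter_of_dependsOn
        (E := {T : ∀ p : ι × ℕ, Ω p.1 | (fun i => T (i, c i + touches L i)) ∈ {a : ∀ i, Ω i | ∀ A ∈ J, a ∈ A}}) _
        (s := Finset.univ.image fun i => (i, c i + touches L i))
        (t := Finset.univ.biUnion fun i => (Finset.range (c i + touches L i)).image fun k => (i, k))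
        (measurableSet_preimage hT hJm) (measurableSet_consistent c hL'),
      infinitePi_read μ _ hJm, pi_layer μ J hJ (hd J List.mem_cons_self),
      ih hL' fun K hK => hd K (List.mem_cons_of_mem _ hK), weight_cons,
      ENNReal.ofReal_mul (by positivity), ENNReal.ofReal_prod_of_nonneg (by simp)]
    · simp
    · intro T T' h
      have : (fun i => T (i, c i + touches L i)) = fun i => T' (i, c i + touches L i) :=
        funext fun i => h (i, c i + touches L i) (by simp)
      simp only [Set.mem_ofPred_eq, this]
    · refine (dependsOn_consistent c L).mono ?_
      rintro ⟨i, k⟩ hk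
      simpa using hk
    · rw [Finset.disjoint_left]
      rintro ⟨i, k⟩ h1 h2
      simp only [Finset.mem_image, Finset.mem_univ, true_and, Prod.mk.injEq, Finset.mem_biUnion,
        Finset.mem_range] at h1 h2
      obtain ⟨_, rfl, rfl⟩ := h1
      obtain ⟨_, _, h3, rfl, rfl⟩ := h2
      exact lt_irrefl _ h3

end Weights

/-! ### Summing the weights of all lists -/

section Counting

variable {ι : Type*} {Ω : ι → Type*} {𝒜 : Finset (Set (∀ i, Ω i))}

open Classical in
/-- The lists of at most `n` nonempty layers below a root with possible children `D`. -/
noncomputable def layerings (𝒜 : Finset (Set (∀ i, Ω i))) :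
    ℕ → Finset (Set (∀ i, Ω i)) → Finset (List (Finset (Set (∀ i, Ω i))))
  | 0, _ => {[]}
  | n + 1, D => insert [] ((D.powerset.erase ∅).biUnion fun J =>
      (layerings 𝒜 n (closedNbhd 𝒜 J)).image (J :: ·))

theorem IsLayering.mem_layerings {n : ℕ} {D : Finset (Set (∀ i, Ω i))}
    {L : List (Finset (Set (∀ i, Ω i)))} (h : IsLayering 𝒜 D L) (hn : L.length ≤ n) :
    L ∈ layerings 𝒜 n D := by
  classical
  induction n generalizing D L with
  | zero => simpa [layerings] using hn
  | succ n ih =>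
    cases L with
    | nil => simp [layerings]
    | cons J L =>
      rw [layerings, Finset.mem_insert, Finset.mem_biUnion]
      exact Or.inr ⟨J, by simpa [h.2.1.ne_empty] using h.1,
        Finset.mem_image_of_mem _ (ih h.2.2.2 (by simpa using hn))⟩

theorem countable_isLayering (D : Finset (Set (∀ i, Ω i))) :
    {L | IsLayering 𝒜 D L}.Countable := by
  refine (Set.countable_iUnion fun n => (layerings 𝒜 n D).countable_toSet).mono fun L hL => ?_
  exact Set.mem_iUnion.2 ⟨L.length, IsLayering.mem_layerings hL le_rfl⟩

/-- Repeated factors only enlarge the right-hand side, as every factor is at least 1. -/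
theorem prod_biUnion_le {α β : Type*} [DecidableEq β] (s : Finset α) (t : α → Finset β)
    {f : β → ℝ} (hf : ∀ a ∈ s, ∀ b ∈ t a, 1 ≤ f b) :
    ∏ b ∈ s.biUnion t, f b ≤ ∏ a ∈ s, ∏ b ∈ t a, f b := by
  classical
  induction s using Finset.induction_on with
  | empty => simp
  | insert a s ha ih =>
    have ih := ih fun c hc => hf c (Finset.mem_insert_of_mem hc)
    have hta := hf a (Finset.mem_insert_self _ _)
    rw [Finset.biUnion_insert, Finset.prod_insert ha]
    have h1 : 1 ≤ ∏ b ∈ t a ∩ s.biUnion t, f b :=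
      Finset.one_le_prod fun b hb => hta b (Finset.mem_inter.1 hb).1
    have h2 : ∀ u, (∀ b ∈ u, 1 ≤ f b) → 0 ≤ ∏ b ∈ u, f b := fun u hu =>
      Finset.prod_nonneg fun b hb => zero_le_one.trans (hu b hb)
    calc ∏ b ∈ t a ∪ s.biUnion t, f b
        ≤ (∏ b ∈ t a ∪ s.biUnion t, f b) * ∏ b ∈ t a ∩ s.biUnion t, f b := by
          refine le_mul_of_one_le_right (h2 _ fun b hb => ?_) h1
          rcases Finset.mem_union.1 hb with hb | hb
          · exact hta b hb
          · obtain ⟨c, hc, hb⟩ := Finset.mem_biUnion.1 hb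
            exact hf c (Finset.mem_insert_of_mem hc) b hb
      _ = (∏ b ∈ t a, f b) * ∏ b ∈ s.biUnion t, f b := Finset.prod_union_inter
      _ ≤ _ := mul_le_mul_of_nonneg_left ih (h2 _ hta)

variable {x : Set (∀ i, Ω i) → ℝ}

theorem one_le_inv_one_sub (hx : ∀ A ∈ 𝒜, x A ∈ Set.Ioo (0 : ℝ) 1) {A : Set (∀ i, Ω i)} (hA : A ∈ 𝒜) : 1 ≤ (1 - x A)⁻¹ :=
  (one_le_inv₀ (by linarith [(hx A hA).2])).2 (by linarith [(hx A hA).1])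

variable [Fintype ι] [∀ i, MeasurableSpace (Ω i)] (μ : ∀ i, Measure (Ω i))

/-- Splitting the closed neighbourhood event by event lets the local lemma condition cancel the
product over each `nbhd 𝒜 A`; only the factor of `A` itself is left. -/
theorem layer_weight_mul_le
    (hx : ∀ A ∈ 𝒜, x A ∈ Set.Ioo (0 : ℝ) 1)
    (hLLL : ∀ A ∈ 𝒜, (Measure.pi μ).real A ≤ x A * ∏ C ∈ nbhd 𝒜 A, (1 - x C))
    {J : Finset (Set (∀ i, Ω i))} (hJ : J ⊆ 𝒜) :
    (∏ A ∈ J, (Measure.pi μ).real A) * ∏ C ∈ closedNbhd 𝒜 J, (1 - x C)⁻¹ ≤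
      ∏ A ∈ J, x A * (1 - x A)⁻¹ := by
  classical
  have hpos : ∀ A ∈ 𝒜, 0 < 1 - x A := fun A hA => by linarith [(hx A hA).2]
  have h1 : ∏ C ∈ closedNbhd 𝒜 J, (1 - x C)⁻¹ ≤
      ∏ A ∈ J, ∏ C ∈ insert A (nbhd 𝒜 A), (1 - x C)⁻¹ := by
    refine prod_biUnion_le _ _ fun A hA C hC => one_le_inv_one_sub hx ?_
    rcases Finset.mem_insert.1 hC with rfl | hC
    exacts [hJ hA, nbhd_subset hC]
  refine (mul_le_mul_of_nonneg_left h1 (by positivity)).trans ?_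
  rw [← Finset.prod_mul_distrib]
  refine Finset.prod_le_prod (fun A hA => mul_nonneg measureReal_nonneg <|
    Finset.prod_nonneg fun C hC => inv_nonneg.2 ?_) fun A hA => ?_
  · rcases Finset.mem_insert.1 hC with rfl | hC
    exacts [(hpos _ (hJ hA)).le, (hpos _ (nbhd_subset hC)).le]
  · have hP : 0 < ∏ C ∈ nbhd 𝒜 A, (1 - x C) :=
      Finset.prod_pos fun C hC => hpos _ (nbhd_subset hC)
    rw [Finset.prod_insert (fun h => (mem_nbhd.1 h).2.1 rfl), Finset.prod_inv_distrib]
    calc (Measure.pi μ).real A * ((1 - x A)⁻¹ * (∏ C ∈ nbhd 𝒜 A, (1 - x C))⁻¹)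
        ≤ (x A * ∏ C ∈ nbhd 𝒜 A, (1 - x C)) *
          ((1 - x A)⁻¹ * (∏ C ∈ nbhd 𝒜 A, (1 - x C))⁻¹) :=
          mul_le_mul_of_nonneg_right (hLLL A (hJ hA))
            (mul_nonneg (inv_nonneg.2 (hpos _ (hJ hA)).le) (inv_nonneg.2 hP.le))
      _ = x A * (1 - x A)⁻¹ := by
          field_simp

/-- Induction on the depth: split off the first layer `J`, bound what lies below it, and expand `∏
(1 + x / (1 - x))` over subsets. Dropping the disjointness of `J` only adds nonnegative terms. -/
theorem sum_weight_layerings_le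
    (hx : ∀ A ∈ 𝒜, x A ∈ Set.Ioo (0 : ℝ) 1)
    (hLLL : ∀ A ∈ 𝒜, (Measure.pi μ).real A ≤ x A * ∏ C ∈ nbhd 𝒜 A, (1 - x C))
    (n : ℕ) {D : Finset (Set (∀ i, Ω i))} (hD : D ⊆ 𝒜) :
    ∑ L ∈ layerings 𝒜 n D, weight μ L ≤ ∏ C ∈ D, (1 - x C)⁻¹ := by
  classical
  induction n generalizing D with
  | zero =>
    simpa [layerings, weight] using
      Finset.one_le_prod fun C hC => one_le_inv_one_sub hx (hD hC)
  | succ n ih =>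
    have hJ : ∀ J ∈ D.powerset.erase ∅, J ⊆ 𝒜 := fun J hJ =>
      (Finset.mem_powerset.1 (Finset.mem_of_mem_erase hJ)).trans hD
    rw [layerings, Finset.sum_insert (by simp)]
    calc weight μ [] + ∑ L ∈ (D.powerset.erase ∅).biUnion fun J =>
            (layerings 𝒜 n (closedNbhd 𝒜 J)).image (J :: ·), weight μ L
        ≤ 1 + ∑ J ∈ D.powerset.erase ∅, ∑ L ∈ (layerings 𝒜 n (closedNbhd 𝒜 J)).image (J :: ·),
            weight μ L := by
          refine add_le_add (by simp [weight]) ?_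
          rw [Finset.sum_biUnion]
          intro J _ K _ hJK
          rw [Function.onFun, Finset.disjoint_left]
          intro L h1 h2
          obtain ⟨_, -, rfl⟩ := Finset.mem_image.1 h1
          obtain ⟨_, -, h⟩ := Finset.mem_image.1 h2
          exact hJK (List.cons.inj h).1.symm
      _ ≤ 1 + ∑ J ∈ D.powerset.erase ∅, ∏ A ∈ J, x A * (1 - x A)⁻¹ := by
          refine add_le_add le_rfl (Finset.sum_le_sum fun J hJD => ?_)
          rw [Finset.sum_image fun _ _ _ _ h => (List.cons.inj h).2]
          simp only [weight_cons, ← Finset.mul_sum]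
          exact (mul_le_mul_of_nonneg_left (ih (closedNbhd_subset (hJ J hJD)))
            (by positivity)).trans (layer_weight_mul_le μ hx hLLL (hJ J hJD))
      -- The 1 from the empty list supplies the term `J = ∅`.
      _ = ∑ J ∈ D.powerset, ∏ A ∈ J, x A * (1 - x A)⁻¹ := by
          rw [← Finset.add_sum_erase _ _ (Finset.empty_mem_powerset D)]
          simp
      _ = ∏ C ∈ D, (1 + x C * (1 - x C)⁻¹) := (Finset.prod_one_add _).symm
      _ = ∏ C ∈ D, (1 - x C)⁻¹ := by
          refine Finset.prod_congr rfl fun C hC => ?_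
          have : (1 : ℝ) - x C ≠ 0 := by linarith [(hx C (hD hC)).2]
          field_simp
          ring

end Counting

/-! ### From a run to its layers -/

section Run

variable {ι : Type*} {Ω : ι → Type*} [∀ i, MeasurableSpace (Ω i)] {𝒜 : Finset (Set (∀ i, Ω i))}
  {Seed : Type*} [MeasurableSpace Seed] {rule : SelectionRule 𝒜 Seed} {ω : Sample Ω Seed} {t : ℕ}

theorem history_succ_of_none (h : rule.pick ω.1 t (history rule ω t).1 = none) :
    history rule ω (t + 1) =
      (Fin.snoc (α := fun _ => ∀ i, Ω i) (history rule ω t).1 (assignment rule ω t),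
        (history rule ω t).2) := by
  rw [history, h]
  rfl

open Classical in
theorem history_succ_of_some {A : 𝒜} (h : rule.pick ω.1 t (history rule ω t).1 = some A) :
    history rule ω (t + 1) =
      (Fin.snoc (α := fun _ => ∀ i, Ω i) (history rule ω t).1
        (fun i => if i ∈ vbl (A : Set (∀ i, Ω i)) then ω.2 (i, (history rule ω t).2 i + 1)
          else assignment rule ω t i),
        fun i => if i ∈ vbl (A : Set (∀ i, Ω i)) then (history rule ω t).2 i + 1
          else (history rule ω t).2 i) := by
  rw [history, h]
  rfl

/-- The assignment at time `t` is read off from the table of draws. -/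
theorem assignment_eq (rule : SelectionRule 𝒜 Seed) (ω : Sample Ω Seed) (t : ℕ) :
    assignment rule ω t = fun i => ω.2 (i, (history rule ω t).2 i) := by
  classical
  induction t with
  | zero => rfl
  | succ t ih =>
    cases h : rule.pick ω.1 t (history rule ω t).1 with
    | none =>
      rw [assignment, history_succ_of_none h]
      simpa using ih
    | some A =>
      funext i
      rw [assignment, history_succ_of_some h]
      simp only [Fin.snoc_last]
      by_cases hi : i ∈ vbl (A : Set (∀ i, Ω i))
      · rw [if_pos hi, if_pos hi]
      · rw [if_neg hi, if_neg hi, ih]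

theorem count_mono (rule : SelectionRule 𝒜 Seed) (ω : Sample Ω Seed) (i : ι) :
    Monotone fun t => (history rule ω t).2 i := by
  classical
  refine monotone_nat_of_le_succ fun t => ?_
  cases h : rule.pick ω.1 t (history rule ω t).1 with
  | none => simp [history_succ_of_none h]
  | some A =>
    rw [history_succ_of_some h]
    dsimp only
    split_ifs <;> omega

theorem count_lt {A : 𝒜} {s : ℕ} {i : ι} (h : rule.pick ω.1 t (history rule ω t).1 = some A)
    (hi : i ∈ vbl (A : Set (∀ i, Ω i))) (hts : t < s) :
    (history rule ω t).2 i < (history rule ω s).2 i := by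
  classical
  refine lt_of_lt_of_le ?_ (count_mono rule ω i (Nat.succ_le_of_lt hts))
  simp [history_succ_of_some h, hi]

/-- Going backwards through a run, the resamplings that matter for the event `B` at time `t` are
collected in layers that are consistent with the table of draws. -/
theorem exists_layering [Finite ι] {B : Set (∀ i, Ω i)} {D : Finset (Set (∀ i, Ω i))}
    (hD : ∀ s < t, ∀ A : 𝒜, rule.pick ω.1 s (history rule ω s).1 = some A →
      Related (A : Set (∀ i, Ω i)) B → (A : Set (∀ i, Ω i)) ∈ D)
    {L : List (Finset (Set (∀ i, Ω i)))} (hL : IsLayering 𝒜 D L)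
    (hc : Consistent ω.2 (history rule ω t).2 ({B} :: L)) :
    ∃ L', IsLayering 𝒜 D L' ∧ Consistent ω.2 0 ({B} :: L') ∧
      ∀ i ∈ vbl B, touches L' i = touches L i + (history rule ω t).2 i := by
  classical
  induction t generalizing L with
  | zero => exact ⟨L, hL, hc, fun i _ => rfl⟩
  | succ t ih =>
    replace ih := @ih fun s hs => hD s (hs.trans t.lt_succ_self)
    cases h : rule.pick ω.1 t (history rule ω t).1 with
    | none =>
      rw [history_succ_of_none h] at hc ⊢
      exact ih hL hc
    | some A =>
      have hk : ∀ i, (history rule ω (t + 1)).2 i =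
          (history rule ω t).2 i + if i ∈ vbl (A : Set (∀ i, Ω i)) then 1 else 0 := fun i => by
        rw [history_succ_of_some h]
        dsimp only
        split_ifs <;> rfl
      have hA : (fun i => ω.2 (i, (history rule ω t).2 i)) ∈ (A : Set (∀ i, Ω i)) := by
        rw [← assignment_eq]
        exact rule.pick_some _ _ _ A h
      obtain ⟨L', h1, h2, h3⟩ := ih
        (hL.graft (I := {B}) A.2 fun ⟨C, hC, hAC⟩ =>
          hD t t.lt_succ_self A h (Finset.mem_singleton.1 hC ▸ hAC))
        (hc.graft hk hA)
      refine ⟨L', h1, h2, fun i hi => ?_⟩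
      rw [h3 i hi, touches_graft_of_mem_layerVbl ⟨B, by simp, hi⟩, hk]
      omega

theorem consistent_root {B : Set (∀ i, Ω i)} (h : assignment rule ω t ∈ B) :
    Consistent ω.2 (history rule ω t).2 [{B}] := by
  rw [assignment_eq] at h
  simpa [Consistent, touches] using h

/-- If `B` is ever true, then the first time gives layers without `B` at depth one. -/
theorem exists_layering_of_mem [Finite ι] {B : Set (∀ i, Ω i)}
    (h : ∃ t, assignment rule ω t ∈ B) :
    ∃ L, IsLayering 𝒜 (nbhd 𝒜 B) L ∧ Consistent ω.2 0 ({B} :: L) := by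
  classical
  -- A picked event is true, so before its first occurrence `B` cannot have been picked.
  have hne : ∀ s < Nat.find h, ∀ A : 𝒜, rule.pick ω.1 s (history rule ω s).1 = some A →
      (A : Set (∀ i, Ω i)) ≠ B := fun s hs A hA hAB =>
    Nat.find_min h hs (hAB ▸ rule.pick_some _ _ _ A hA)
  obtain ⟨L, h1, h2, -⟩ := exists_layering (t := Nat.find h) (D := nbhd 𝒜 B) (L := [])
    (fun s hs A hA hAB => mem_nbhd.2 ⟨A.2, hne s hs A hA, hAB.resolve_left (hne s hs A hA)⟩)
    trivial (consistent_root (Nat.find_spec h))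
  exact ⟨L, h1, h2⟩

/-- An event that is the root of only finitely many consistent lists of layers is resampled only
finitely often. -/
theorem finite_pick [Finite ι] {A : 𝒜} (hA : (vbl (A : Set (∀ i, Ω i))).Nonempty)
    (hfin : {L | IsLayering 𝒜 (closedNbhd 𝒜 {(A : Set (∀ i, Ω i))}) L ∧
      Consistent ω.2 0 ({(A : Set (∀ i, Ω i))} :: L)}.Finite) :
    {t | rule.pick ω.1 t (history rule ω t).1 = some A}.Finite := by
  classical
  obtain ⟨i, hi⟩ := hA
  have key : ∀ t, rule.pick ω.1 t (history rule ω t).1 = some A →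
      ∃ L, IsLayering 𝒜 (closedNbhd 𝒜 {(A : Set (∀ i, Ω i))}) L ∧
        Consistent ω.2 0 ({(A : Set (∀ i, Ω i))} :: L) ∧
        touches L i = (history rule ω t).2 i := fun t ht => by
    obtain ⟨L, h1, h2, h3⟩ := exists_layering (t := t)
      (D := closedNbhd 𝒜 {(A : Set (∀ i, Ω i))}) (L := [])
      (fun s _ C _ hCA => MeetsLayer.mem_closedNbhd C.2 ⟨A, by simp, hCA⟩) trivial
      (consistent_root (rule.pick_some _ _ _ A ht))
    exact ⟨L, h1, h2, by simpa [touches] using h3 i hi⟩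
  refine Set.Finite.of_finite_image (f := fun t => (history rule ω t).2 i)
    ((hfin.image fun L => touches L i).subset ?_) ?_
  · rintro _ ⟨t, ht, rfl⟩
    obtain ⟨L, h1, h2, h3⟩ := key t ht
    exact ⟨L, ⟨h1, h2⟩, h3⟩
  -- Each resampling of `A` strictly increases the counter of `i`, so the counter tells these times
  -- apart.
  · intro s hs t ht hst
    rcases lt_trichotomy s t with h | h | h
    · exact absurd hst (count_lt hs hi h).ne
    · exact h
    · exact absurd hst (count_lt ht hi h).ne'

theorem exists_stoppedAt
    (h : ∀ A : 𝒜, {t | rule.pick ω.1 t (history rule ω t).1 = some A}.Finite) :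
    ∃ t, StoppedAt rule ω t := by
  by_contra! hne
  obtain ⟨o, ho⟩ := Finite.exists_infinite_fiber fun t => rule.pick ω.1 t (history rule ω t).1
  rw [Set.infinite_coe_iff] at ho
  cases o with
  | none =>
    obtain ⟨t, ht⟩ := ho.nonempty
    exact hne t ht
  | some A => exact ho (h A)

end Run

/-! ### Total probability of consistent lists -/

section Bounds

theorem IsLayering.forall_mem {ι : Type*} {Ω : ι → Type*} {𝒜 D : Finset (Set (∀ i, Ω i))} (hD : D ⊆ 𝒜) :
    ∀ {L}, IsLayering 𝒜 D L → ∀ J ∈ L, J ⊆ 𝒜 ∧ (J : Set (Set (∀ i, Ω i))).PairwiseDisjoint vbl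
  | [], _ => by simp
  | J :: L, h => by
    rw [List.forall_mem_cons]
    exact ⟨⟨h.1.trans hD, h.2.2.1⟩,
      IsLayering.forall_mem (closedNbhd_subset (h.1.trans hD)) h.2.2.2⟩

variable {ι : Type*} [Fintype ι] {Ω : ι → Type*} [∀ i, MeasurableSpace (Ω i)]
  (μ : ∀ i, Measure (Ω i)) [∀ i, IsProbabilityMeasure (μ i)]
  {𝒜 : Finset (Set (∀ i, Ω i))} {x : Set (∀ i, Ω i) → ℝ}

theorem tsum_consistent_le (h𝒜 : ∀ A ∈ 𝒜, MeasurableSet A)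
    (hx : ∀ A ∈ 𝒜, x A ∈ Set.Ioo (0 : ℝ) 1)
    (hLLL : ∀ A ∈ 𝒜, (Measure.pi μ).real A ≤ x A * ∏ C ∈ nbhd 𝒜 A, (1 - x C))
    {Seed : Type*} [MeasurableSpace Seed] (ν : Measure Seed) [IsProbabilityMeasure ν]
    {B : Set (∀ i, Ω i)} (hB : MeasurableSet B) {D : Finset (Set (∀ i, Ω i))} (hD : D ⊆ 𝒜) :
    ∑' L : {L | IsLayering 𝒜 D L},
        runMeasure μ ν {ω | Consistent ω.2 0 ({B} :: (L : List (Finset (Set (∀ i, Ω i)))))} ≤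
      ENNReal.ofReal ((Measure.pi μ).real B * ∏ C ∈ D, (1 - x C)⁻¹) := by
  classical
  have hval : ∀ L : {L | IsLayering 𝒜 D L},
      runMeasure μ ν {ω | Consistent ω.2 0 ({B} :: (L : List (Finset (Set (∀ i, Ω i)))))} =
        ENNReal.ofReal ((Measure.pi μ).real B * weight μ (L : List (Finset (Set (∀ i, Ω i))))) := by
    rintro ⟨L, hL⟩
    have hL := IsLayering.forall_mem hD hL
    have hm : ∀ J ∈ {B} :: L, ∀ A ∈ J, MeasurableSet A := by
      rw [List.forall_mem_cons]
      exact ⟨by simpa using hB, fun J hJ A hA => h𝒜 A ((hL J hJ).1 hA)⟩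
    have h := (measurePreserving_snd (μ := ν)
      (ν := Measure.infinitePi fun p : ι × ℕ => μ p.1)).measure_preimage
      (measurableSet_consistent 0 hm).nullMeasurableSet
    rw [infinitePi_consistent μ 0 hm (by
      rw [List.forall_mem_cons]
      exact ⟨by simp, fun J hJ => (hL J hJ).2⟩), weight_cons, Finset.prod_singleton] at h
    exact h
  simp only [hval]
  rw [ENNReal.tsum_eq_iSup_sum]
  refine iSup_le fun s => ?_
  rw [← ENNReal.ofReal_sum_of_nonneg fun L _ => mul_nonneg measureReal_nonneg (weight_nonneg μ _),
    ← Finset.mul_sum]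
  refine ENNReal.ofReal_le_ofReal (mul_le_mul_of_nonneg_left ?_ measureReal_nonneg)
  -- Finitely many lists have bounded length, so the finite-depth bound applies.
  refine le_trans ?_ (sum_weight_layerings_le μ hx hLLL (s.sup fun L => L.1.length) hD)
  refine (Finset.sum_map s (Function.Embedding.subtype _) (weight μ)).symm.trans_le ?_
  refine Finset.sum_le_sum_of_subset_of_nonneg (fun L hL => ?_) fun L _ _ => weight_nonneg μ L
  obtain ⟨L, hLs, rfl⟩ := Finset.mem_map.1 hL
  exact IsLayering.mem_layerings L.2 (Finset.le_sup (f := fun L => L.1.length) hLs)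

/-- The local lemma condition excludes bad events that do not depend on any variable. -/
theorem vbl_nonempty (hx : ∀ A ∈ 𝒜, x A ∈ Set.Ioo (0 : ℝ) 1)
    (hLLL : ∀ A ∈ 𝒜, (Measure.pi μ).real A ≤ x A * ∏ C ∈ nbhd 𝒜 A, (1 - x C))
    {A : Set (∀ i, Ω i)} (hA : A ∈ 𝒜) {a : ∀ i, Ω i} (ha : a ∈ A) : (vbl A).Nonempty := by
  by_contra hne
  rw [Set.not_nonempty_iff_eq_empty] at hne
  have huniv : A = Set.univ := Set.eq_univ_of_forall fun b =>
    (mem_congr fun i hi => absurd hi (by simp [hne])).1 ha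
  have h1 : (Measure.pi μ).real A = 1 := by simp [huniv]
  have h2 : ∏ C ∈ nbhd 𝒜 A, (1 - x C) ≤ 1 := Finset.prod_le_one
    (fun C hC => by linarith [(hx C (nbhd_subset hC)).2])
    fun C hC => by linarith [(hx C (nbhd_subset hC)).1]
  have h3 := hLLL A hA
  rw [h1] at h3
  nlinarith [(hx A hA).1, (hx A hA).2]

end Bounds

end MoserTardos

/-! ### Termination and the bound for `B` -/

theorem theorem2p2 {ι : Type*} [Fintype ι] {Ω : ι → Type*} [∀ i, MeasurableSpace (Ω i)]
    (μ : ∀ i, Measure (Ω i)) [∀ i, IsProbabilityMeasure (μ i)]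
    (𝒜 : Finset (Set (∀ i, Ω i))) (h𝒜 : ∀ A ∈ 𝒜, MeasurableSet A)
    (x : Set (∀ i, Ω i) → ℝ) (hx : ∀ A ∈ 𝒜, x A ∈ Set.Ioo (0 : ℝ) 1)
    (hLLL : ∀ A ∈ 𝒜,
      (Measure.pi μ).real A ≤ x A * ∏ C ∈ MoserTardos.nbhd 𝒜 A, (1 - x C))
    {Seed : Type*} [MeasurableSpace Seed] (ν : Measure Seed) [IsProbabilityMeasure ν]
    (rule : MoserTardos.SelectionRule 𝒜 Seed) :
    (∀ᵐ ω ∂(MoserTardos.runMeasure μ ν), (MoserTardos.output rule ω).isSome) ∧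
    ∀ B : Set (∀ i, Ω i), MeasurableSet B →
      (MoserTardos.runMeasure μ ν).real {ω | ∃ t, MoserTardos.assignment rule ω t ∈ B} ≤
        (Measure.pi μ).real B * (∏ C ∈ MoserTardos.nbhd 𝒜 B, (1 - x C))⁻¹ ∧
      (MoserTardos.runMeasure μ ν).real {ω | ∃ a ∈ MoserTardos.output rule ω, a ∈ B} ≤
        (Measure.pi μ).real B * (∏ C ∈ MoserTardos.nbhd 𝒜 B, (1 - x C))⁻¹ := by
  classical
  open MoserTardos in
  have : IsProbabilityMeasure (runMeasure μ ν) := by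
    unfold runMeasure
    infer_instance
  refine ⟨?_, fun B hB => ?_⟩
  · have hfin : ∀ A : 𝒜, ∀ᵐ ω ∂(runMeasure μ ν),
        {t | rule.pick ω.1 t (history rule ω t).1 = some A}.Finite := fun A => by
      have hA : closedNbhd 𝒜 {(A : Set (∀ i, Ω i))} ⊆ 𝒜 := closedNbhd_subset (by simp)
      have : Countable {L | IsLayering 𝒜 (closedNbhd 𝒜 {(A : Set (∀ i, Ω i))}) L} :=
        (countable_isLayering _).to_subtype
      -- Borel–Cantelli for the lists rooted at `A`.
      filter_upwards [ae_finite_setOfPred_mem ((tsum_consistent_le μ h𝒜 hx hLLL ν (h𝒜 A A.2)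
        hA).trans_lt ENNReal.ofReal_lt_top).ne] with ω hω
      by_cases hne : (vbl (A : Set (∀ i, Ω i))).Nonempty
      · refine finite_pick hne ((hω.image Subtype.val).subset ?_)
        exact fun L hL => ⟨⟨L, hL.1⟩, hL.2, rfl⟩
      · refine Set.finite_empty.subset fun t ht => ?_
        exact hne (vbl_nonempty μ hx hLLL A.2 (rule.pick_some _ _ _ A ht))
    filter_upwards [ae_all_iff.2 hfin] with ω hω
    rw [output, dif_pos (exists_stoppedAt hω)]
    rfl
  · have hpos : 0 ≤ (∏ C ∈ nbhd 𝒜 B, (1 - x C))⁻¹ := inv_nonneg.2 <|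
      Finset.prod_nonneg fun C hC => by linarith [(hx C (nbhd_subset hC)).2]
    have hmain : (runMeasure μ ν).real {ω | ∃ t, assignment rule ω t ∈ B} ≤
        (Measure.pi μ).real B * (∏ C ∈ nbhd 𝒜 B, (1 - x C))⁻¹ := by
      refine ENNReal.toReal_le_of_le_ofReal (mul_nonneg measureReal_nonneg hpos) ?_
      rw [← Finset.prod_inv_distrib]
      refine le_trans ?_ (tsum_consistent_le μ h𝒜 hx hLLL ν hB nbhd_subset)
      -- Monotonicity and countable subadditivity hold for outer measure, so the covered event need
      -- not be shown measurable.
      refine le_trans (measure_mono fun ω hω => ?_) (measure_biUnion_le _ (countable_isLayering _)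
        fun L => {ω : Sample Ω Seed | Consistent ω.2 0 ({B} :: L)})
      obtain ⟨L, h1, h2⟩ := exists_layering_of_mem hω
      exact Set.mem_biUnion h1 h2
    refine ⟨hmain, (measureReal_mono ?_).trans hmain⟩
    rintro ω ⟨a, ha, haB⟩
    rw [output] at ha
    split_ifs at ha with h
    · rw [Option.mem_some_iff] at ha
      exact ⟨Nat.find h, ha ▸ haB⟩
    · simp at ha
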